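/- **Setting.** An instance is a finite connected simple graph $G=(V,E)$ with $n=|V|\ge 1$ nodes, together with pairwise distinct identifiers $\mathsf{id}(v)\in\{1,\dots,n^c\}$, $v\in V$, where $c\ge 1$ is a fixed integer. A certificate is a finite bit string. A verifier is an algorithm (a computable function) that, given the identifier $\mathsf{id}(v)$ of a node $v$, the certificate $c(v)$ of $v$, and the multiset of the certificates $c(w)$ of the neighbors $w$ of $v$, outputs accept or reject. A proof-labeling scheme (PLS) for a class $\mathcal F$ of graphs, with certificates of at most $s(n)$ bits on $n$-node graphs, consists of a verifier such that for every instance $(G,\mathsf{id})$: * (completeness) if $G\in\mathcal F$, then certificates of at most $s(n)$ bits can be assigned to the nodes so that the verifier accepts at every node; * (soundness) if $G\notin\mathcal F$, then for every assignment of certificates, of whatever size, the verifier rejects in at least one node. **Theorem.** The class of induced-$P_4$-free graphs (the graphs without a path on four vertices as an induced subgraph, i.e. the cographs) can be certified with a PLS using $O(\log n)$-bit certificates in $n$-node graphs. More precisely, there is a verifier such that, for every integer $c\ge 1$, there is a function $s:\mathbb N\to\mathbb N$ with $s(n)=O(\log n)$ as $n\to\infty$ (the implied constant may depend on $c$) for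 which this verifier gives a PLS for the class of induced-$P_4$-free graphs with certificates of at most $s(n)$ bits on $n$-node graphs with identifiers in $\{1,\dots,n^c\}$. -/

import Mathlib

open Asymptotics Filter

universe u

/-- The (induced) `P₄`-free graphs: no path on four vertices is an induced subgraph of `G`. -/
def InducedP4Free (V : Type u) (G : SimpleGraph V) : Prop :=
  ¬ (SimpleGraph.pathGraph 4).IsIndContained G

namespace PLS

/-- A certificate is a finite bit string; its size is its length. -/
abbrev Certificate : Type := List Bool

/-- Identifiers are pairwise distinct integers in `[1, n ^ c]`, where `n` is the number of nodes. -/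
def IsIdAssignment {V : Type u} [Fintype V] (c : ℕ) (ident : V → ℕ) : Prop :=
  Function.Injective ident ∧ ∀ v, 1 ≤ ident v ∧ ident v ≤ Fintype.card V ^ c

/-- The verifier run by every node. Its input is the identifier of the node, the certificate of the
node, and the certificates received from its neighbors, one from each of them (a multiset: the
outcome does not depend on the order in which they arrive). Its output is `true` for "accept" and
`false` for "reject". It is an algorithm: the output is a computable function of the input, the
received certificates being presented as a list in any order. -/
structure Verifier where
  output : ℕ → Certificate → Multiset Certificate → Bool
  computable : Computable fun x : ℕ × Certificate × List Certificate =>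
    output x.1 x.2.1 (x.2.2 : Multiset Certificate)

open Classical in
/-- The certificates that `v` receives in the single round of communication. -/
noncomputable def received {V : Type u} [Fintype V] (G : SimpleGraph V) (cert : V → Certificate)
    (v : V) : Multiset Certificate :=
  (Finset.univ.filter fun w => G.Adj v w).val.map cert

/-- The node `v` accepts. -/
def Verifier.AcceptsAt (A : Verifier) {V : Type u} [Fintype V] (G : SimpleGraph V) (ident : V → ℕ)
    (cert : V → Certificate) (v : V) : Prop :=
  A.output (ident v) (cert v) (received G cert v) = true

/-- `A` is the verifier of a proof-labeling scheme for the graph class `P`, with certificates of at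
most `s n` bits on `n`-node graphs. The instances are the connected finite simple graphs with
identifiers in `[1, n ^ c]`. Completeness: if the graph is in `P` then the prover can assign
certificates of at most `s n` bits such that all nodes accept. Soundness: if the graph is not in
`P` then for every certificate assignment (of whatever size) some node rejects. -/
def Verifier.Certifies (A : Verifier) (c : ℕ) (s : ℕ → ℕ)
    (P : (V : Type u) → SimpleGraph V → Prop) : Prop :=
  ∀ (V : Type u) [Fintype V] (G : SimpleGraph V) (ident : V → ℕ),
    G.Connected → IsIdAssignment c ident →
      (P V G → ∃ cert : V → Certificate,
        (∀ v, (cert v).length ≤ s (Fintype.card V)) ∧ ∀ v, A.AcceptsAt G ident cert v) ∧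
      (¬ P V G → ∀ cert : V → Certificate, ∃ v, ¬ A.AcceptsAt G ident cert v)

end PLS

/-! A connected cograph with at least two vertices is a join of two sides
(`InducedP4Free.exists_join`), so every node sees the whole opposite side. The complement of `P₄` is
connected, so an induced `P₄` of a join lies inside one side. It therefore suffices that each node
can reconstruct the graph induced on the opposite side from the certificates it receives, and test
it for induced `P₄`s.

Adjacency inside a side is encoded in logarithmic space by a permutation model: each node gets a
segment, and adjacent means crossing (`InducedP4Free.exists_crossing`). The model is checked by
counting. A node verifies that its neighbors on its own side cross it and that their number is its
claimed degree; any node of the other side verifies that the crossings within the side number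
exactly that degree. One set contains the other and the sizes agree, so crossing is adjacency
(`adj_iff_cross_of_valid`).

The join is also checked by counting. For each side a commonly known identifier names a hub that
every node of the side sees. The hub confirms the claimed size of the side, and every node opposite
must have that many neighbors there (`adj_of_valid`). -/

/-! ### Induced paths and cuts of cographs. -/

/-- `a`, `b`, `c`, `d` are the consecutive vertices of an induced path of the relation `r`. -/
def IsInducedP4 {α : Type*} (r : α → α → Prop) (a b c d : α) : Prop :=
  r a b ∧ r b c ∧ r c d ∧ ¬ r a c ∧ ¬ r b d ∧ ¬ r a d

/-- Distinctness need not be required: identifying two non-consecutive vertices would make one of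
the three edges a forbidden chord. -/
theorem inducedP4Free_iff {V : Type u} {G : SimpleGraph V} :
    InducedP4Free V G ↔ ∀ a b c d, ¬ IsInducedP4 G.Adj a b c d := by
  rw [InducedP4Free, not_iff_comm]
  push Not
  constructor
  · rintro ⟨a, b, c, d, hab, hbc, hcd, hac, hbd, had⟩
    have hac' : a ≠ c := by rintro rfl; exact had hcd
    have hbd' : b ≠ d := by rintro rfl; exact had hab
    have had' : a ≠ d := by rintro rfl; exact hac hcd.symm
    have hne := And.intro hab.ne (And.intro hbc.ne hcd.ne)
    refine ⟨⟨⟨![a, b, c, d], ?_⟩, ?_⟩⟩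
    · intro i j hij
      fin_cases i <;> fin_cases j <;> simp_all [eq_comm]
    · intro i j
      change G.Adj (![a, b, c, d] i) (![a, b, c, d] j) ↔ _
      have hca : ¬ G.Adj c a := fun h => hac h.symm
      have hdb : ¬ G.Adj d b := fun h => hbd h.symm
      have hda : ¬ G.Adj d a := fun h => had h.symm
      fin_cases i <;> fin_cases j <;>
        simp [SimpleGraph.pathGraph_adj, hab, hab.symm, hbc, hbc.symm, hcd, hcd.symm, hac, hca,
          hbd, hdb, had, hda]
  · rintro ⟨f⟩
    refine ⟨f 0, f 1, f 2, f 3, ?_⟩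
    simp [IsInducedP4, SimpleGraph.pathGraph_adj]

/-- `P₄` is self-complementary: the non-edges of `a b c d` form the path `c a d b`. -/
theorem InducedP4Free.compl {V : Type u} {G : SimpleGraph V} (h : InducedP4Free V G) :
    InducedP4Free V Gᶜ := by
  rw [inducedP4Free_iff] at h ⊢
  rintro a b c d ⟨hab, hbc, hcd, hac, hbd, had⟩
  have hac' : a ≠ c := by rintro rfl; exact had hcd
  have hbd' : b ≠ d := by rintro rfl; exact had hab
  have had' : a ≠ d := by rintro rfl; exact hac hcd.symm
  simp only [SimpleGraph.compl_adj, not_and, not_not] at hab hbc hcd hac hbd had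
  refine h c a d b ⟨(hac hac').symm, had had', (hbd hbd').symm, ?_, ?_, ?_⟩
  · exact hcd.2
  · exact hab.2
  · exact fun h => hbc.2 h.symm

/-- `S` is partitioned into two nonempty parts with no edge of `G` between them. -/
def SimpleGraph.IsCut {V : Type u} (G : SimpleGraph V) (S A B : Finset V) : Prop :=
  A.Nonempty ∧ B.Nonempty ∧ Disjoint A B ∧ (A : Set V) ∪ B = S ∧ ∀ a ∈ A, ∀ b ∈ B, ¬ G.Adj a b

/-- If `v` has no neighbor in `B`, it joins `A`. Otherwise the non-neighbors of `v` in `A`, among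
them `w`, can be split off from everything else. -/
theorem SimpleGraph.IsCut.exists_insert {V : Type u} [DecidableEq V] {G : SimpleGraph V}
    (hG : InducedP4Free V G) {S A B : Finset V} {v w : V} (h : G.IsCut S A B) (hv : v ∉ S)
    (hw : w ∈ A) (hvw : ¬ G.Adj v w) : ∃ A' B', G.IsCut (insert v S) A' B' := by
  classical
  obtain ⟨hA, hB, hAB, hS, hcut⟩ := h
  have hmem : ∀ x, x ∈ S ↔ x ∈ A ∨ x ∈ B := fun x => by
    rw [← Finset.mem_coe, ← hS]; simp
  have hvA : v ∉ A := fun h => hv ((hmem v).2 (.inl h))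
  have hvB : v ∉ B := fun h => hv ((hmem v).2 (.inr h))
  by_cases hz : ∃ z ∈ B, G.Adj v z
  · obtain ⟨z, hzB, hvz⟩ := hz
    -- An edge `x y` would complete the induced path `z v x y`.
    have hxy : ∀ x ∈ A, ∀ y ∈ A, G.Adj v x → ¬ G.Adj v y → ¬ G.Adj x y := by
      intro x hx y hy hvx hvy hxy
      refine inducedP4Free_iff.1 hG z v x y ⟨hvz.symm, hvx, hxy, ?_, hvy, ?_⟩
      · exact fun h => hcut x hx z hzB h.symm
      · exact fun h => hcut y hy z hzB h.symm
    refine ⟨A.filter fun x => ¬ G.Adj v x, insert v (B ∪ A.filter fun x => G.Adj v x),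
      ⟨w, by simp [hw, hvw]⟩, ⟨v, by simp⟩, ?_, ?_, ?_⟩
    · rw [Finset.disjoint_left] at hAB ⊢
      intro x hx
      simp only [Finset.mem_filter, Finset.mem_insert, Finset.mem_union] at hx ⊢
      have := hAB hx.1
      rintro (rfl | hxB | hxA)
      · exact hvA hx.1
      · exact this hxB
      · exact hx.2 hxA.2
    · ext x
      simp only [Set.mem_union, Finset.mem_coe, Finset.mem_filter, Finset.mem_insert,
        Finset.mem_union, hmem]
      tauto
    · intro a ha b hb
      simp only [Finset.mem_filter, Finset.mem_insert, Finset.mem_union] at ha hb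
      rcases hb with rfl | hb | hb
      · exact fun h => ha.2 h.symm
      · exact hcut a ha.1 b hb
      · exact fun h => hxy b hb.1 a ha.1 hb.2 ha.2 h.symm
  · push Not at hz
    refine ⟨insert v A, B, by simp, hB, ?_, ?_, ?_⟩
    · simpa [Finset.disjoint_insert_left, hvB] using hAB
    · ext x
      simp only [Set.mem_union, Finset.mem_coe, Finset.mem_insert, hmem]
      tauto
    · intro a ha b hb
      rcases Finset.mem_insert.1 ha with rfl | ha
      exacts [hz b hb, hcut a ha b hb]

theorem SimpleGraph.IsCut.symm {V : Type u} {G : SimpleGraph V} {S A B : Finset V}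
    (h : G.IsCut S A B) : G.IsCut S B A :=
  ⟨h.2.1, h.1, h.2.2.1.symm, Set.union_comm _ _ ▸ h.2.2.2.1,
    fun b hb a ha hba => h.2.2.2.2 a ha b hb hba.symm⟩

/-- Either `v` misses some vertex of `S` and the cut extends, or `v` dominates `S` and is isolated
in the complement. -/
theorem SimpleGraph.IsCut.exists_insert_or_compl {V : Type u} [DecidableEq V] {G : SimpleGraph V}
    (hG : InducedP4Free V G) {S A B : Finset V} {v : V} (h : G.IsCut S A B) (hv : v ∉ S) :
    ∃ A' B', G.IsCut (insert v S) A' B' ∨ Gᶜ.IsCut (insert v S) A' B' := by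
  have hmem : ∀ x, x ∈ S ↔ x ∈ A ∨ x ∈ B := fun x => by
    rw [← Finset.mem_coe, ← h.2.2.2.1]; simp
  by_cases hw : ∃ w ∈ S, ¬ G.Adj v w
  · obtain ⟨w, hwS, hvw⟩ := hw
    obtain ⟨A', B', h'⟩ : ∃ A' B', G.IsCut (insert v S) A' B' := by
      rcases (hmem w).1 hwS with hw | hw
      · exact h.exists_insert hG hv hw hvw
      · exact h.symm.exists_insert hG hv hw hvw
    exact ⟨A', B', .inl h'⟩
  · push Not at hw
    refine ⟨{v}, S, .inr ⟨by simp, ?_, by simpa using hv, by simp, ?_⟩⟩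
    · exact h.1.mono fun x hx => (hmem x).2 (.inl hx)
    · simpa using fun b hb _ => hw b hb

/-- Every set of at least two vertices of a `P₄`-free graph is disconnected in the graph or in its
complement. -/
theorem InducedP4Free.exists_isCut {V : Type u} {G : SimpleGraph V} (hG : InducedP4Free V G)
    (S : Finset V) (hS : S.Nontrivial) : ∃ A B, G.IsCut S A B ∨ Gᶜ.IsCut S A B := by
  classical
  induction S using Finset.induction_on with
  | empty => simp at hS
  | insert v S hv ih =>
    by_cases hS' : S.Nontrivial
    · obtain ⟨A, B, h | h⟩ := ih hS'
      · exact h.exists_insert_or_compl hG hv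
      -- The hypothesis is closed under complement, so this case is the previous one with `G` and
      -- `Gᶜ` exchanged.
      · obtain ⟨A', B', h'⟩ := h.exists_insert_or_compl hG.compl hv
        rw [compl_compl] at h'
        exact ⟨A', B', h'.symm⟩
    · have hne : S.Nonempty := by
        rw [Finset.nonempty_iff_ne_empty]
        rintro rfl
        simp at hS
      obtain ⟨w, rfl⟩ : ∃ w, S = {w} := by
        rcases hne.exists_eq_singleton_or_nontrivial with h | h
        exacts [h, absurd h hS']
      have hvw : v ≠ w := by simpa using hv
      refine ⟨{v}, {w}, ?_⟩
      by_cases hadj : G.Adj v w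
      · exact .inr ⟨by simp, by simp, by simpa using hvw, by ext; simp [or_comm],
          by simpa using fun _ => hadj⟩
      · exact .inl ⟨by simp, by simp, by simpa using hvw, by ext; simp [or_comm],
          by simpa using hadj⟩

/-! ### Permutation models and joins. -/

/-- The segments `x₁ y₁` and `x₂ y₂` between two parallel lines cross. -/
def Crossing (x₁ y₁ x₂ y₂ : ℕ) : Prop :=
  (x₁ < x₂ ∧ y₂ < y₁) ∨ (x₂ < x₁ ∧ y₁ < y₂)

/-- A `P₄`-free graph is a permutation graph. -/
theorem InducedP4Free.exists_crossing {V : Type u} {G : SimpleGraph V} (hG : InducedP4Free V G)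
    (S : Finset V) : ∃ x y : V → ℕ, (∀ v ∈ S, x v < S.card ∧ y v < S.card) ∧
      ∀ u ∈ S, ∀ v ∈ S, G.Adj u v ↔ Crossing (x u) (y u) (x v) (y v) := by
  classical
  induction S using Finset.strongInduction with
  | H S ih =>
    by_cases hS : S.Nontrivial
    · have key : ∀ A B : Finset V, G.IsCut S A B ∨ Gᶜ.IsCut S A B → A.Nonempty ∧ B.Nonempty ∧
          Disjoint A B ∧ A ∪ B = S := by
        rintro A B (h | h) <;> exact ⟨h.1, h.2.1, h.2.2.1, by exact_mod_cast h.2.2.2.1⟩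
      obtain ⟨A, B, hcut⟩ := hG.exists_isCut S hS
      obtain ⟨hA, hB, hAB, rfl⟩ := key A B hcut
      have hB' : ∀ v ∈ B, v ∉ A := fun v hv hv' => Finset.disjoint_left.1 hAB hv' hv
      obtain ⟨x₁, y₁, hb₁, h₁⟩ := ih A <| by
        obtain ⟨b, hb⟩ := hB
        exact Finset.ssubset_iff_subset_ne.2 ⟨Finset.subset_union_left, fun h =>
          hB' b hb (h ▸ Finset.mem_union_right _ hb)⟩
      obtain ⟨x₂, y₂, hb₂, h₂⟩ := ih B <| by
        obtain ⟨a, ha⟩ := hA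
        exact Finset.ssubset_iff_subset_ne.2 ⟨Finset.subset_union_right, fun h =>
          hB' a (h ▸ Finset.mem_union_left _ ha) ha⟩
      have hc := Finset.card_union_of_disjoint hAB
      have hcross : (∀ a ∈ A, ∀ b ∈ B, ¬ G.Adj a b) ∨ (∀ a ∈ A, ∀ b ∈ B, G.Adj a b) := by
        refine hcut.imp (fun h => h.2.2.2.2) fun h a ha b hb => ?_
        by_contra hab
        refine h.2.2.2.2 a ha b hb ⟨?_, hab⟩
        rintro rfl
        exact hB' a hb ha
      rcases hcross with hcross | hcross
      -- Disjoint union: the two models are placed side by side, so no segments of different parts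
      -- cross.
      · refine ⟨fun v => if v ∈ A then x₁ v else A.card + x₂ v,
          fun v => if v ∈ A then y₁ v else A.card + y₂ v, ?_, ?_⟩
        · intro v hv
          rcases Finset.mem_union.1 hv with hv | hv
          · have := hb₁ v hv
            simp only [hv, if_true]; omega
          · have := hb₂ v hv
            simp only [hB' v hv, if_false]; omega
        · intro u hu v hv
          rcases Finset.mem_union.1 hu with hu | hu <;> rcases Finset.mem_union.1 hv with hv | hv
          · simpa [hu, hv] using h₁ u hu v hv
          · have := hb₁ u hu
            simp only [hu, hB' v hv, if_true, if_false, hcross u hu v hv, Crossing, false_iff]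
            omega
          · have := hb₁ v hv
            simp only [hv, hB' u hu, if_true, if_false, G.adj_comm u v, hcross v hv u hu,
              Crossing, false_iff]
            omega
          · simpa [hB' u hu, hB' v hv, Crossing] using h₂ u hu v hv
      -- Join: the order of the two blocks is reversed on the lower line only, so all segments of
      -- different parts cross.
      · refine ⟨fun v => if v ∈ A then x₁ v else A.card + x₂ v,
          fun v => if v ∈ A then B.card + y₁ v else y₂ v, ?_, ?_⟩
        · intro v hv
          rcases Finset.mem_union.1 hv with hv | hv
          · have := hb₁ v hv
            simp only [hv, if_true]; omega
          · have := hb₂ v hv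
            simp only [hB' v hv, if_false]; omega
        · intro u hu v hv
          rcases Finset.mem_union.1 hu with hu | hu <;> rcases Finset.mem_union.1 hv with hv | hv
          · simpa [hu, hv, Crossing] using h₁ u hu v hv
          · have := hb₁ u hu
            have := hb₂ v hv
            simp only [hu, hB' v hv, if_true, if_false, hcross u hu v hv, Crossing, true_iff]
            omega
          · have := hb₁ v hv
            have := hb₂ u hu
            simp only [hv, hB' u hu, if_true, if_false, G.adj_comm u v, hcross v hv u hu,
              Crossing, true_iff]
            omega
          · simpa [hB' u hu, hB' v hv, Crossing] using h₂ u hu v hv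
    · refine ⟨fun _ => 0, fun _ => 0, fun v hv => ?_, fun u hu v hv => ?_⟩
      · simpa using ⟨v, hv⟩
      · rw [Finset.Nontrivial, Set.not_nontrivial_iff] at hS
        obtain rfl := hS hu hv
        simp [Crossing]

/-- A connected `P₄`-free graph on at least two vertices is a join. -/
theorem InducedP4Free.exists_join {V : Type u} [Fintype V] [Nontrivial V] {G : SimpleGraph V}
    (hG : InducedP4Free V G) (hconn : G.Connected) :
    ∃ side : V → Bool, (∀ b, ∃ v, side v = b) ∧ ∀ u v, side u ≠ side v → G.Adj u v := by
  classical
  obtain ⟨A, B, h | h⟩ := hG.exists_isCut Finset.univ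
    (by simpa [Finset.Nontrivial] using Set.nontrivial_univ)
  · obtain ⟨⟨a, ha⟩, ⟨b, hb⟩, hAB, hS, hcut⟩ := h
    exfalso
    have hstep : ∀ u v, G.Reachable u v → u ∈ A → v ∈ A := by
      rintro u v ⟨p⟩
      induction p with
      | nil => exact id
      | @cons u v w huv _ ih =>
        intro hu
        have hv : v ∈ A ∨ v ∈ B := by
          have : v ∈ (A : Set V) ∪ B := hS ▸ by simp
          simpa using this
        exact ih (hv.resolve_right fun hv => hcut u hu v hv huv)
    exact Finset.disjoint_left.1 hAB (hstep a b (hconn.preconnected a b) ha) hb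
  · obtain ⟨⟨a, ha⟩, ⟨b, hb⟩, hAB, hS, hcut⟩ := h
    have hmem : ∀ v, v ∉ A → v ∈ B := fun v hv => by
      have : v ∈ (A : Set V) ∪ B := hS ▸ by simp
      exact (by simpa using this : v ∈ A ∨ v ∈ B).resolve_left hv
    have hadj : ∀ u ∈ A, ∀ v ∉ A, G.Adj u v := by
      intro u hu v hv
      by_contra huv
      exact hcut u hu v (hmem v hv) ⟨by rintro rfl; exact hv hu, huv⟩
    refine ⟨fun v => decide (v ∈ A), ?_, fun u v huv => ?_⟩
    · rintro (_ | _)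
      · exact ⟨b, by simpa using fun h => Finset.disjoint_left.1 hAB h hb⟩
      · exact ⟨a, by simpa using ha⟩
    · by_cases hu : u ∈ A <;> by_cases hv : v ∈ A <;> simp [hu, hv] at huv
      exacts [hadj u hu v hv, (hadj v hv u hu).symm]

/-! ### Primitive recursive list predicates. -/

section Computability

variable {α β : Type*} [Primcodable α] [Primcodable β]

theorem PrimrecPred.forall_mem {f : α → List β} {p : α → β → Prop} (hf : Primrec f)
    (hp : PrimrecRel p) : PrimrecPred fun a => ∀ b ∈ f a, p a b :=
  (PrimrecRel.forall_mem_list (R := fun b a => p a b) (hp.comp Primrec.snd Primrec.fst)).comp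
    hf Primrec.id

theorem PrimrecPred.forall_mem₄ {f : α → List β} {p : α → β → β → β → β → Prop} (hf : Primrec f)
    (hp : PrimrecPred fun x : (((α × β) × β) × β) × β =>
      p x.1.1.1.1 x.1.1.1.2 x.1.1.2 x.1.2 x.2) :
    PrimrecPred fun a => ∀ b ∈ f a, ∀ c ∈ f a, ∀ d ∈ f a, ∀ e ∈ f a, p a b c d e := by
  have h₁ : PrimrecPred fun x : ((α × β) × β) × β =>
      ∀ e ∈ f x.1.1.1, p x.1.1.1 x.1.1.2 x.1.2 x.2 e :=
    .forall_mem (hf.comp (Primrec.fst.comp (Primrec.fst.comp Primrec.fst))) hp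
  have h₂ : PrimrecPred fun x : (α × β) × β =>
      ∀ d ∈ f x.1.1, ∀ e ∈ f x.1.1, p x.1.1 x.1.2 x.2 d e :=
    .forall_mem (hf.comp (Primrec.fst.comp Primrec.fst)) h₁
  have h₃ : PrimrecPred fun x : α × β =>
      ∀ c ∈ f x.1, ∀ d ∈ f x.1, ∀ e ∈ f x.1, p x.1 x.2 c d e :=
    .forall_mem (hf.comp Primrec.fst) h₂
  exact .forall_mem hf h₃

theorem PrimrecPred.exists_mem {f : α → List β} {p : α → β → Prop} (hf : Primrec f)
    (hp : PrimrecRel p) : PrimrecPred fun a => ∃ b ∈ f a, p a b :=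
  (PrimrecRel.exists_mem_list (R := fun b a => p a b) (hp.comp Primrec.snd Primrec.fst)).comp
    hf Primrec.id

theorem Primrec.list_countP {f : α → List β} {p : α → β → Prop} [DecidableRel p]
    (hf : Primrec f) (hp : PrimrecRel p) : Primrec fun a => (f a).countP fun b => p a b := by
  have h : PrimrecRel fun b a => p a b := hp.comp Primrec.snd Primrec.fst
  refine (Primrec.list_length.comp (h.listFilter.comp hf Primrec.id)).of_eq fun a => ?_
  simp [List.countP_eq_length_filter]

theorem PrimrecPred.imp {p q : α → Prop} (hp : PrimrecPred p) (hq : PrimrecPred q) :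
    PrimrecPred fun a => p a → q a :=
  (hp.not.or hq).of_eq fun _ => imp_iff_not_or.symm

end Computability

/-! ### Decoding certificates and the local test. -/

namespace PLS.Certificate

/-- The number with the given binary digits, least significant first. -/
def toNat (l : Certificate) : ℕ := l.foldr Nat.bit 0

/-- The part of the certificate that is the same at all nodes. -/
def common (l : Certificate) : ℕ := l.toNat.unpair.1

/-- The identifier of a node that is adjacent to all nodes of the side `b`. -/
def hub (l : Certificate) (b : Bool) : ℕ :=
  cond b l.common.unpair.1.unpair.1 l.common.unpair.1.unpair.2

/-- The number of nodes of the side `b`. -/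
def count (l : Certificate) (b : Bool) : ℕ :=
  cond b l.common.unpair.2.unpair.1 l.common.unpair.2.unpair.2

/-- The side of the node in the join. -/
def side (l : Certificate) : Bool := l.toNat.unpair.2.unpair.1.unpair.1.bodd

/-- The identifier of the node. -/
def ident (l : Certificate) : ℕ := l.toNat.unpair.2.unpair.1.unpair.2

/-- The number of neighbors of the node on its own side. -/
def degree (l : Certificate) : ℕ := l.toNat.unpair.2.unpair.2.unpair.1

/-- The upper end of the segment of the node in the permutation model. -/
def top (l : Certificate) : ℕ := l.toNat.unpair.2.unpair.2.unpair.2.unpair.1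

/-- The lower end of the segment of the node in the permutation model. -/
def bottom (l : Certificate) : ℕ := l.toNat.unpair.2.unpair.2.unpair.2.unpair.2

/-- The segments of the two nodes cross. -/
def Cross (k l : Certificate) : Prop := Crossing k.top k.bottom l.top l.bottom

/-- Only this direction is needed: every bit string decodes to some fields, so soundness meets no
malformed certificates. -/
theorem toNat_bits (n : ℕ) : toNat n.bits = n := by
  induction n using Nat.binaryRec' with
  | zero => rfl
  | bit b n h ih => rw [Nat.bits_append_bit n b h, toNat, List.foldr_cons, ← toNat, ih]

theorem primrec_toNat : Primrec toNat := by
  have hb : Primrec₂ Nat.bit :=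
    (Primrec.cond Primrec.fst (Primrec.nat_double_succ.comp Primrec.snd)
      (Primrec.nat_double.comp Primrec.snd)).of_eq fun x => by
        obtain ⟨_ | _, n⟩ := x <;> rfl
  exact Primrec.list_foldr Primrec.id (Primrec.const 0)
    (hb.comp (Primrec.fst.comp Primrec.snd) (Primrec.snd.comp Primrec.snd)).to₂

theorem primrec_unpair_fst : Primrec fun n : ℕ => n.unpair.1 := Primrec.fst.comp Primrec.unpair

theorem primrec_unpair_snd : Primrec fun n : ℕ => n.unpair.2 := Primrec.snd.comp Primrec.unpair

theorem primrec_common : Primrec common := primrec_unpair_fst.comp primrec_toNat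

theorem primrec_hub : Primrec₂ hub :=
  have h := primrec_unpair_fst.comp (primrec_common.comp Primrec.fst)
  Primrec.cond Primrec.snd (primrec_unpair_fst.comp h) (primrec_unpair_snd.comp h)

theorem primrec_count : Primrec₂ count :=
  have h := primrec_unpair_snd.comp (primrec_common.comp Primrec.fst)
  Primrec.cond Primrec.snd (primrec_unpair_fst.comp h) (primrec_unpair_snd.comp h)

theorem primrec_side : Primrec side :=
  Primrec.nat_bodd.comp <| primrec_unpair_fst.comp <| primrec_unpair_fst.comp <|
    primrec_unpair_snd.comp primrec_toNat

theorem primrec_ident : Primrec ident :=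
  primrec_unpair_snd.comp <| primrec_unpair_fst.comp <| primrec_unpair_snd.comp primrec_toNat

theorem primrec_degree : Primrec degree :=
  primrec_unpair_fst.comp <| primrec_unpair_snd.comp <| primrec_unpair_snd.comp primrec_toNat

theorem primrec_top : Primrec top :=
  primrec_unpair_fst.comp <| primrec_unpair_snd.comp <| primrec_unpair_snd.comp <|
    primrec_unpair_snd.comp primrec_toNat

theorem primrec_bottom : Primrec bottom :=
  primrec_unpair_snd.comp <| primrec_unpair_snd.comp <| primrec_unpair_snd.comp <|
    primrec_unpair_snd.comp primrec_toNat

theorem primrecRel_cross : PrimrecRel Cross :=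
  have lt {f g : Certificate × Certificate → ℕ} (hf : Primrec f) (hg : Primrec g) :
      PrimrecPred fun x => f x < g x := Primrec.nat_lt.comp hf hg
  have t₁ := primrec_top.comp (Primrec.fst (α := Certificate) (β := Certificate))
  have t₂ := primrec_top.comp (Primrec.snd (α := Certificate) (β := Certificate))
  have b₁ := primrec_bottom.comp (Primrec.fst (α := Certificate) (β := Certificate))
  have b₂ := primrec_bottom.comp (Primrec.snd (α := Certificate) (β := Certificate))
  ((lt t₁ t₂).and (lt b₂ b₁)).or ((lt t₂ t₁).and (lt b₁ b₂))

open Classical in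
/-- The test performed by a node with identifier `i` and certificate `l` that receives `m`. -/
def Valid (i : ℕ) (l : Certificate) (m : Multiset Certificate) : Prop :=
  l.ident = i ∧
  (∀ w ∈ m, w.common = l.common) ∧
  (∃ w ∈ m, w.side ≠ l.side ∧ w.ident = l.hub l.side) ∧
  (m.countP fun w => w.side ≠ l.side) = l.count (!l.side) ∧
  (∀ w ∈ m, w.side = l.side → l.Cross w) ∧
  (m.countP fun w => w.side = l.side) = l.degree ∧
  (∀ u ∈ m, u.side ≠ l.side →
    (m.countP fun w => w.side ≠ l.side ∧ u.Cross w) = u.degree) ∧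
  ∀ p ∈ m, ∀ q ∈ m, ∀ r ∈ m, ∀ s ∈ m,
    p.side ≠ l.side ∧ q.side ≠ l.side ∧ r.side ≠ l.side ∧ s.side ≠ l.side →
      ¬ IsInducedP4 Cross p q r s

theorem primrecPred_valid :
    PrimrecPred fun x : ℕ × Certificate × List Certificate =>
      Valid x.1 x.2.1 (x.2.2 : Multiset Certificate) := by
  classical
  simp only [Valid, Multiset.mem_coe, Multiset.coe_countP]
  have hl : Primrec fun x : ℕ × Certificate × List Certificate => x.2.1 :=
    Primrec.fst.comp Primrec.snd
  have hm : Primrec fun x : ℕ × Certificate × List Certificate => x.2.2 :=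
    Primrec.snd.comp Primrec.snd
  have hs : PrimrecRel fun (x : ℕ × Certificate × List Certificate) (w : Certificate) =>
      w.side = x.2.1.side :=
    Primrec.eq.comp (primrec_side.comp Primrec.snd) (primrec_side.comp (hl.comp Primrec.fst))
  have hw {γ : Type} [Primcodable γ] {f : γ → Certificate}
      {g : γ → ℕ × Certificate × List Certificate} (hf : Primrec f) (hg : Primrec g) :
      PrimrecPred fun x => (f x).side ≠ (g x).2.1.side := hs.not.comp hg hf
  refine .and ?_ <| .and ?_ <| .and ?_ <| .and ?_ <| .and ?_ <| .and ?_ <| .and ?_ ?_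
  · exact Primrec.eq.comp (primrec_ident.comp hl) Primrec.fst
  · exact .forall_mem hm (Primrec.eq.comp (primrec_common.comp Primrec.snd)
      (primrec_common.comp (hl.comp Primrec.fst)))
  · exact .exists_mem hm (.and hs.not (Primrec.eq.comp (primrec_ident.comp Primrec.snd)
      ((primrec_hub.comp hl (primrec_side.comp hl)).comp Primrec.fst)))
  · exact Primrec.eq.comp (.list_countP hm hs.not)
      (primrec_count.comp hl (Primrec.not.comp (primrec_side.comp hl)))
  · exact .forall_mem hm (.imp hs (primrecRel_cross.comp (hl.comp Primrec.fst) Primrec.snd))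
  · exact Primrec.eq.comp (.list_countP hm hs) (primrec_degree.comp hl)
  · refine .forall_mem hm (.imp hs.not (Primrec.eq.comp (.list_countP (hm.comp Primrec.fst) ?_)
      (primrec_degree.comp Primrec.snd)))
    exact .and (hw Primrec.snd (Primrec.fst.comp Primrec.fst))
      (primrecRel_cross.comp (Primrec.snd.comp Primrec.fst) Primrec.snd)
  · have coord {γ : Type} [Primcodable γ] :
        (Primrec fun t : (((γ × Certificate) × Certificate) × Certificate) × Certificate =>
          t.1.1.1.1) ∧
        (Primrec fun t : (((γ × Certificate) × Certificate) × Certificate) × Certificate =>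
          t.1.1.1.2) ∧
        (Primrec fun t : (((γ × Certificate) × Certificate) × Certificate) × Certificate =>
          t.1.1.2) ∧
        (Primrec fun t : (((γ × Certificate) × Certificate) × Certificate) × Certificate =>
          t.1.2) ∧
        Primrec fun t : (((γ × Certificate) × Certificate) × Certificate) × Certificate => t.2 :=
      ⟨Primrec.fst.comp (Primrec.fst.comp (Primrec.fst.comp Primrec.fst)),
        Primrec.snd.comp (Primrec.fst.comp (Primrec.fst.comp Primrec.fst)),
        Primrec.snd.comp (Primrec.fst.comp Primrec.fst), Primrec.snd.comp Primrec.fst, Primrec.snd⟩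
    obtain ⟨hx, hp, hq, hr, hs⟩ := coord (γ := ℕ × Certificate × List Certificate)
    refine .forall_mem₄ hm (.imp ?_ (PrimrecPred.not ?_))
    · exact (hw hp hx).and <| (hw hq hx).and <| (hw hr hx).and (hw hs hx)
    · exact .and (primrecRel_cross.comp hp hq) <| .and (primrecRel_cross.comp hq hr) <|
        .and (primrecRel_cross.comp hr hs) <| .and (primrecRel_cross.comp hp hr).not <|
        .and (primrecRel_cross.comp hq hs).not (primrecRel_cross.comp hp hs).not

end PLS.Certificate

namespace PLS

open Classical in
/-- A node accepts if it has no neighbors or its certificate is valid. -/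
noncomputable def cographVerifier : Verifier where
  output i l m := decide (m = 0 ∨ Certificate.Valid i l m)
  computable := by
    have h : PrimrecPred fun x : ℕ × Certificate × List Certificate =>
        (x.2.2 : Multiset Certificate) = 0 ∨ Certificate.Valid x.1 x.2.1 x.2.2 := by
      refine .or ?_ Certificate.primrecPred_valid
      exact (Primrec.eq.comp (Primrec.snd.comp Primrec.snd) (Primrec.const [])).of_eq (by simp)
    obtain ⟨_, h⟩ := h
    exact h.to_comp.of_eq fun x => by congr

end PLS

/-! ### Soundness. -/

namespace PLS

theorem mem_received {V : Type u} [Fintype V] {G : SimpleGraph V} {cert : V → Certificate}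
    {v : V} {l : Certificate} : l ∈ received G cert v ↔ ∃ w, G.Adj v w ∧ cert w = l := by
  simp [received]

theorem countP_received {V : Type u} [Fintype V] (G : SimpleGraph V) (cert : V → Certificate)
    (v : V) (p : Certificate → Prop) [DecidablePred p]
    [DecidablePred fun w => G.Adj v w ∧ p (cert w)] :
    (received G cert v).countP p = (Finset.univ.filter fun w => G.Adj v w ∧ p (cert w)).card := by
  classical
  rw [received, Multiset.countP_map, Finset.card_def, Finset.filter_val, Finset.filter_val,
    Multiset.filter_filter]
  exact congrArg _ (Multiset.filter_congr fun w _ => and_comm)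

theorem acceptsAt_cographVerifier {V : Type u} [Fintype V] {G : SimpleGraph V} {ident : V → ℕ}
    {cert : V → Certificate} {v : V} : cographVerifier.AcceptsAt G ident cert v ↔
      received G cert v = 0 ∨ (cert v).Valid (ident v) (received G cert v) := by
  simp [Verifier.AcceptsAt, cographVerifier]

section Soundness

variable {V : Type u} [Fintype V] {G : SimpleGraph V} {ident : V → ℕ} {cert : V → Certificate}

theorem common_eq_of_valid (hG : G.Connected)
    (h : ∀ v, (cert v).Valid (ident v) (received G cert v)) (u v : V) :
    (cert u).common = (cert v).common := by
  obtain ⟨p⟩ := hG.preconnected u v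
  induction p with
  | nil => rfl
  | @cons u v w huv _ ih => exact ((h u).2.1 _ (mem_received.2 ⟨v, huv, rfl⟩)).symm.trans ih

theorem hub_eq_of_valid (hG : G.Connected)
    (h : ∀ v, (cert v).Valid (ident v) (received G cert v)) (u v : V) :
    (cert u).hub = (cert v).hub := by
  funext b
  rw [Certificate.hub, Certificate.hub, common_eq_of_valid hG h u v]

theorem count_eq_of_valid (hG : G.Connected)
    (h : ∀ v, (cert v).Valid (ident v) (received G cert v)) (u v : V) :
    (cert u).count = (cert v).count := by
  funext b
  rw [Certificate.count, Certificate.count, common_eq_of_valid hG h u v]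

/-- All nodes of a side look for the same identifier among their neighbors, and identifiers are
verified and distinct, so they all find the same node. -/
theorem exists_hub_of_valid (hG : G.Connected) (hid : Function.Injective ident)
    (h : ∀ v, (cert v).Valid (ident v) (received G cert v)) (v : V) :
    ∃ r, (cert r).side ≠ (cert v).side ∧ ∀ u, (cert u).side = (cert v).side → G.Adj r u := by
  have key : ∀ u, ∃ r, G.Adj u r ∧ (cert r).side ≠ (cert u).side ∧
      ident r = (cert u).hub (cert u).side := by
    intro u
    obtain ⟨w, hw, hside, hident⟩ := (h u).2.2.1
    obtain ⟨r, hr, rfl⟩ := mem_received.1 hw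
    exact ⟨r, hr, hside, (h r).1 ▸ hident⟩
  obtain ⟨r, _, hr, hri⟩ := key v
  refine ⟨r, hr, fun u hu => ?_⟩
  obtain ⟨r', hr', _, hri'⟩ := key u
  obtain rfl : r' = r := hid (by rw [hri, hri', hub_eq_of_valid hG h u v, hu])
  exact hr'.symm

theorem exists_side_ne_of_valid (h : ∀ v, (cert v).Valid (ident v) (received G cert v)) (v : V) :
    ∃ r, (cert r).side ≠ (cert v).side := by
  obtain ⟨w, hw, hside, -⟩ := (h v).2.2.1
  obtain ⟨r, hr, rfl⟩ := mem_received.1 hw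
  exact ⟨r, hside⟩

/-- The hub `r` of the side of `v` is on the side of `u`. Both have the same number of neighbors
across, and those of `r` are the entire side of `v`, so those of `u` are too. -/
theorem adj_of_valid (hG : G.Connected) (hid : Function.Injective ident)
    (h : ∀ v, (cert v).Valid (ident v) (received G cert v)) {u v : V}
    (huv : (cert u).side ≠ (cert v).side) : G.Adj u v := by
  classical
  obtain ⟨r, hr, hadj⟩ := exists_hub_of_valid hG hid h v
  have hur : (cert u).side = (cert r).side := by
    revert huv hr
    cases (cert u).side <;> cases (cert r).side <;> cases (cert v).side <;> decide
  have hcr := (h r).2.2.2.1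
  have hcu := (h u).2.2.2.1
  rw [countP_received] at hcr hcu
  rw [count_eq_of_valid hG h u r, hur, ← hcr] at hcu
  have hsub : (Finset.univ.filter fun w => G.Adj u w ∧ (cert w).side ≠ (cert r).side) ⊆
      Finset.univ.filter fun w => G.Adj r w ∧ (cert w).side ≠ (cert r).side := by
    intro w hw
    rw [Finset.mem_filter] at hw ⊢
    refine ⟨hw.1, hadj w ?_, hw.2.2⟩
    have := hw.2.2
    revert this hr
    cases (cert w).side <;> cases (cert r).side <;> cases (cert v).side <;> decide
  have hv : v ∈ Finset.univ.filter fun w => G.Adj r w ∧ (cert w).side ≠ (cert r).side := by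
    simpa using ⟨hadj v rfl, hr.symm⟩
  rw [← Finset.eq_of_subset_of_card_le hsub hcu.ge] at hv
  exact (Finset.mem_filter.1 hv).2.1

/-- Neighbors of `u` on its side cross `u`. A node `r` of the other side sees that whole side and
counts as many crossings as `u` has such neighbors, so the inclusion is an equality. -/
theorem adj_iff_cross_of_valid (hG : G.Connected) (hid : Function.Injective ident)
    (h : ∀ v, (cert v).Valid (ident v) (received G cert v)) {u v : V}
    (huv : (cert u).side = (cert v).side) : G.Adj u v ↔ (cert u).Cross (cert v) := by
  classical
  obtain ⟨r, hr⟩ := exists_side_ne_of_valid h u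
  have hru : G.Adj r u := adj_of_valid hG hid h hr
  have hdeg := (h u).2.2.2.2.2.1
  have hdeg' := (h r).2.2.2.2.2.2.1 _ (mem_received.2 ⟨u, hru, rfl⟩) hr.symm
  rw [countP_received] at hdeg hdeg'
  have hsub : (Finset.univ.filter fun w => G.Adj u w ∧ (cert w).side = (cert u).side) ⊆
      Finset.univ.filter fun w =>
        G.Adj r w ∧ (cert w).side ≠ (cert r).side ∧ (cert u).Cross (cert w) := by
    intro w hw
    rw [Finset.mem_filter] at hw ⊢
    have hwr : (cert w).side ≠ (cert r).side := hw.2.2.trans_ne hr.symm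
    exact ⟨hw.1, (adj_of_valid hG hid h hwr).symm, hwr,
      (h u).2.2.2.2.1 _ (mem_received.2 ⟨w, hw.2.1, rfl⟩) hw.2.2⟩
  have hcard := (hdeg'.trans hdeg.symm).le
  have heq := Finset.eq_of_subset_of_card_le hsub hcard
  have hvr : (cert v).side ≠ (cert r).side := huv.symm.trans_ne hr.symm
  have hv := Finset.ext_iff.1 heq v
  simp only [Finset.mem_filter, Finset.mem_univ, true_and] at hv
  exact ⟨fun h' => (hv.1 ⟨h', huv.symm⟩).2.2,
    fun h' => (hv.2 ⟨(adj_of_valid hG hid h hvr).symm, hvr, h'⟩).1⟩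

theorem inducedP4Free_of_valid (hG : G.Connected) (hid : Function.Injective ident)
    (h : ∀ v, (cert v).Valid (ident v) (received G cert v)) : InducedP4Free V G := by
  rw [inducedP4Free_iff]
  rintro a b c d hP
  -- The non-edges `a c`, `a d`, `b d` connect all four vertices, which forces them onto one side.
  have hside : ∀ u v, ¬ G.Adj u v → (cert u).side = (cert v).side := fun u v huv => by
    by_contra hne
    exact huv (adj_of_valid hG hid h hne)
  have hac := hside a c hP.2.2.2.1
  have hbd := hside b d hP.2.2.2.2.1
  have had := hside a d hP.2.2.2.2.2
  obtain ⟨r, hr⟩ := exists_side_ne_of_valid h a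
  have hr' : ∀ v, (cert a).side = (cert v).side →
      (cert v).side ≠ (cert r).side ∧ cert v ∈ received G cert r := fun v hv =>
    have hvr : (cert v).side ≠ (cert r).side := hv.symm.trans_ne hr.symm
    ⟨hvr, mem_received.2 ⟨v, (adj_of_valid hG hid h hvr).symm, rfl⟩⟩
  have ha := hr' a rfl
  have hb := hr' b (had.trans hbd.symm)
  have hc := hr' c hac
  have hd := hr' d had
  refine (h r).2.2.2.2.2.2.2 _ ha.2 _ hb.2 _ hc.2 _ hd.2 ⟨ha.1, hb.1, hc.1, hd.1⟩ ?_
  have hiff {u v : V} (hu : (cert a).side = (cert u).side) (hv : (cert a).side = (cert v).side) :=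
    adj_iff_cross_of_valid hG hid h (hu.symm.trans hv)
  have hab := had.trans hbd.symm
  rw [IsInducedP4, hiff rfl hab, hiff hab hac, hiff hac had, hiff rfl hac, hiff hab had,
    hiff rfl had] at hP
  exact hP

theorem inducedP4Free_of_acceptsAt (hG : G.Connected) (hid : Function.Injective ident)
    (h : ∀ v, cographVerifier.AcceptsAt G ident cert v) : InducedP4Free V G := by
  rcases subsingleton_or_nontrivial V with _ | _
  · rw [inducedP4Free_iff]
    exact fun a b c d hP => hP.1.ne (Subsingleton.elim _ _)
  · refine inducedP4Free_of_valid (cert := cert) hG hid fun v => ?_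
    obtain ⟨w, hw⟩ := hG.preconnected.exists_adj_of_nontrivial v
    refine (acceptsAt_cographVerifier.1 (h v)).resolve_left fun h0 => ?_
    have : cert w ∈ received G cert v := mem_received.2 ⟨w, hw, rfl⟩
    simp [h0] at this

end Soundness

/-! ### Encoding and completeness. -/

namespace Certificate

/-- The certificate with the given fields. -/
def pack (hub count : Bool → ℕ) (side : Bool) (ident degree top bottom : ℕ) : Certificate :=
  (Nat.pair (Nat.pair (Nat.pair (hub true) (hub false)) (Nat.pair (count true) (count false)))
    (Nat.pair (Nat.pair side.toNat ident) (Nat.pair degree (Nat.pair top bottom)))).bits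

variable (h c : Bool → ℕ) (b : Bool) (i d x y : ℕ)

theorem common_pack (b' : Bool) (i' d' x' y' : ℕ) :
    (pack h c b i d x y).common = (pack h c b' i' d' x' y').common := by
  simp [pack, common, toNat_bits]

theorem hub_pack : (pack h c b i d x y).hub = h := by
  funext b; cases b <;> simp [pack, hub, common, toNat_bits]

theorem count_pack : (pack h c b i d x y).count = c := by
  funext b; cases b <;> simp [pack, count, common, toNat_bits]

theorem side_pack : (pack h c b i d x y).side = b := by
  cases b <;> simp [pack, side, toNat_bits]

theorem ident_pack : (pack h c b i d x y).ident = i := by simp [pack, ident, toNat_bits]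

theorem degree_pack : (pack h c b i d x y).degree = d := by simp [pack, degree, toNat_bits]

theorem top_pack : (pack h c b i d x y).top = x := by simp [pack, top, toNat_bits]

theorem bottom_pack : (pack h c b i d x y).bottom = y := by simp [pack, bottom, toNat_bits]

theorem _root_.Nat.pair_lt_two_pow {a b k : ℕ} (ha : a < 2 ^ k) (hb : b < 2 ^ k) :
    Nat.pair a b < 2 ^ (2 * k) := by
  refine (Nat.pair_lt_max_add_one_sq a b).trans_le ?_
  rw [mul_comm, pow_mul]
  exact Nat.pow_le_pow_left (max_lt ha hb) 2

/-- Each `Nat.pair` at most doubles the bit length, and pairs are nested four deep, whence the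
factor `16`. -/
theorem length_pack_le {k : ℕ} (hh : ∀ b, h b < 2 ^ k) (hc : ∀ b, c b < 2 ^ k) (hb : 1 ≤ k)
    (hi : i < 2 ^ k) (hd : d < 2 ^ k) (hx : x < 2 ^ k) (hy : y < 2 ^ k) :
    (pack h c b i d x y).length ≤ 16 * k := by
  have mono : ∀ {n j j' : ℕ}, j ≤ j' → n < 2 ^ j → n < 2 ^ j' := fun hj hn =>
    hn.trans_le (Nat.pow_le_pow_right two_pos hj)
  have hside : b.toNat < 2 ^ k :=
    (Bool.toNat_lt b).trans_le (by simpa using Nat.pow_le_pow_right two_pos hb)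
  rw [pack, Nat.size_eq_bits_len, Nat.size_le, show 16 * k = 2 * (2 * (2 * (2 * k))) by ring]
  refine Nat.pair_lt_two_pow (mono (by omega) (Nat.pair_lt_two_pow
    (Nat.pair_lt_two_pow (hh _) (hh _)) (Nat.pair_lt_two_pow (hc _) (hc _))))
    (Nat.pair_lt_two_pow (mono (by omega) (Nat.pair_lt_two_pow hside hi)) ?_)
  exact Nat.pair_lt_two_pow (mono (by omega) hd) (Nat.pair_lt_two_pow hx hy)

end Certificate

theorem exists_cert {V : Type u} [Fintype V] [Nontrivial V] {G : SimpleGraph V} {ident : V → ℕ}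
    (hG : G.Connected) (hP : InducedP4Free V G) {k : ℕ} (hk : 1 ≤ k)
    (hcard : Fintype.card V < 2 ^ k) (hident : ∀ v, ident v < 2 ^ k) :
    ∃ cert : V → Certificate, (∀ v, (cert v).length ≤ 16 * k) ∧
      ∀ v, (cert v).Valid (ident v) (received G cert v) := by
  classical
  obtain ⟨side, hside, hjoin⟩ := hP.exists_join hG
  obtain ⟨x, y, hxy, hcross⟩ := hP.exists_crossing Finset.univ
  choose rep hrep using hside
  set deg : V → ℕ := fun v => (Finset.univ.filter fun w => G.Adj v w ∧ side w = side v).card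
    with hdeg
  set num : Bool → ℕ := fun b => (Finset.univ.filter fun w => side w = b).card with hnum
  -- In a join any node can serve as hub of the opposite side, hence the negation in `rep !b`.
  set cert : V → Certificate := fun v =>
    Certificate.pack (fun b => ident (rep !b)) num (side v) (ident v) (deg v) (x v) (y v)
    with hcert
  have hne : ∀ b b' : Bool, b ≠ b' ↔ b = !b' := by decide
  have hs : ∀ v, (cert v).side = side v := fun v => Certificate.side_pack ..
  have hc : ∀ u v, (cert u).Cross (cert v) ↔ G.Adj u v := fun u v => by
    rw [Certificate.Cross, hcert, Certificate.top_pack, Certificate.top_pack,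
      Certificate.bottom_pack, Certificate.bottom_pack]
    exact (hcross u (Finset.mem_univ u) v (Finset.mem_univ v)).symm
  refine ⟨cert, fun v => Certificate.length_pack_le _ _ _ _ _ _ _ (fun _ => hident _)
    (fun _ => (Finset.card_le_univ _).trans_lt hcard) hk (hident v)
    ((Finset.card_le_univ _).trans_lt hcard) ((hxy v (Finset.mem_univ v)).1.trans hcard)
    ((hxy v (Finset.mem_univ v)).2.trans hcard), fun v => ?_⟩
  refine ⟨Certificate.ident_pack .., ?_, ?_, ?_, ?_, ?_, ?_, ?_⟩
  · rintro _ hw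
    obtain ⟨w, -, rfl⟩ := mem_received.1 hw
    exact Certificate.common_pack ..
  · have hr : side (rep !side v) ≠ side v := by rw [hrep]; simp
    refine ⟨cert (rep !side v), mem_received.2 ⟨_, (hjoin _ _ hr).symm, rfl⟩, ?_, ?_⟩
    · rwa [hs, hs]
    · rw [hs, hcert, Certificate.hub_pack, Certificate.ident_pack]
  · rw [countP_received, hcert, Certificate.count_pack, ← hcert]
    simp only [hs, hnum]
    congr 1
    ext w
    simp only [Finset.mem_filter, Finset.mem_univ, true_and, ← hne]
    exact ⟨fun h => h.2, fun h => ⟨(hjoin _ _ h).symm, h⟩⟩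
  · rintro _ hw -
    obtain ⟨w, hvw, rfl⟩ := mem_received.1 hw
    exact (hc v w).2 hvw
  · rw [countP_received, hcert, Certificate.degree_pack, ← hcert]
    simp only [hs, hdeg]
  · rintro _ hu huv
    obtain ⟨u, -, rfl⟩ := mem_received.1 hu
    rw [hs, hs] at huv
    rw [countP_received, hcert, Certificate.degree_pack, ← hcert]
    simp only [hs, hc, hdeg]
    congr 1
    ext w
    simp only [Finset.mem_filter, Finset.mem_univ, true_and]
    have hiff : side w ≠ side v ↔ side w = side u := by rw [hne, (hne _ _).1 huv]
    rw [hiff]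
    exact ⟨fun h => ⟨h.2.2, h.2.1⟩, fun h => ⟨(hjoin _ _ (hiff.2 h.2)).symm, h.2, h.1⟩⟩
  · rintro _ hp _ hq _ hr _ hs' - hP4
    obtain ⟨p, -, rfl⟩ := mem_received.1 hp
    obtain ⟨q, -, rfl⟩ := mem_received.1 hq
    obtain ⟨r, -, rfl⟩ := mem_received.1 hr
    obtain ⟨s, -, rfl⟩ := mem_received.1 hs'
    simp only [IsInducedP4, hc] at hP4
    exact inducedP4Free_iff.1 hP p q r s hP4

/-! ### Certificate size and conclusion. -/

theorem isBigO_size (C : ℕ) :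
    (fun n => ((C * Nat.size n : ℕ) : ℝ)) =O[atTop] (fun n : ℕ => Real.log (n : ℝ)) := by
  refine IsBigO.of_bound (C * (2 / Real.log 2)) ?_
  filter_upwards [eventually_ge_atTop 2] with n hn
  have hlog2 : 0 < Real.log 2 := Real.log_pos one_lt_two
  have hn' : (2 : ℝ) ≤ n := by exact_mod_cast hn
  have hlog : Real.log 2 ≤ Real.log n := Real.log_le_log two_pos hn'
  have hsize : Nat.size n ≤ Nat.log 2 n + 1 :=
    Nat.size_le.2 (Nat.lt_pow_succ_log_self one_lt_two n)
  have hnat : (Nat.log 2 n : ℝ) ≤ Real.log n / Real.log 2 := by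
    rw [Real.log_div_log]
    exact_mod_cast Real.natLog_le_logb n 2
  -- This absorbs the extra `1` in the bit length, at the price of the factor `2`.
  have hone : 1 ≤ Real.log n / Real.log 2 := (one_le_div hlog2).2 hlog
  have hsize' : (Nat.size n : ℝ) ≤ Nat.log 2 n + 1 := by exact_mod_cast hsize
  rw [Real.norm_of_nonneg (Nat.cast_nonneg _), Real.norm_of_nonneg (hlog2.le.trans hlog),
    Nat.cast_mul, mul_assoc]
  refine mul_le_mul_of_nonneg_left ?_ (Nat.cast_nonneg _)
  calc (Nat.size n : ℝ) ≤ Real.log n / Real.log 2 + Real.log n / Real.log 2 := by linarith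
    _ = 2 / Real.log 2 * Real.log n := by ring

/-- Identifiers are at most `n ^ c`, so `c * Nat.size n` bits hold every field. A one-node graph is
no join; its node has no neighbors and accepts the empty certificate. -/
theorem cographVerifier_certifies {c : ℕ} (hc : 1 ≤ c) :
    cographVerifier.Certifies c (fun n => 16 * c * Nat.size n) InducedP4Free.{u} := by
  intro V _ G ident hG hid
  refine ⟨fun hP => ?_, fun hP cert => ?_⟩
  · rcases subsingleton_or_nontrivial V with _ | _
    · refine ⟨fun _ => [], by simp, fun v => acceptsAt_cographVerifier.2 (.inl ?_)⟩
      refine Multiset.eq_zero_of_forall_notMem fun l hl => ?_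
      obtain ⟨w, hw, -⟩ := mem_received.1 hl
      exact hw.ne (Subsingleton.elim _ _)
    · have hcard := Nat.lt_size_self (Fintype.card V)
      have hpos : 1 ≤ Nat.size (Fintype.card V) := Nat.size_pos.2 Fintype.card_pos
      have hpow : Fintype.card V ^ c < 2 ^ (c * Nat.size (Fintype.card V)) := by
        rw [mul_comm, pow_mul]
        exact Nat.pow_lt_pow_left hcard (by omega)
      obtain ⟨cert, hlen, hvalid⟩ := exists_cert hG hP (Nat.mul_pos hc hpos)
        (hcard.trans_le (Nat.pow_le_pow_right two_pos (Nat.le_mul_of_pos_left _ hc)))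
        (fun v => (hid.2 v).2.trans_lt hpow)
      exact ⟨cert, fun v => (hlen v).trans_eq (by ring), fun v =>
        acceptsAt_cographVerifier.2 (.inr (hvalid v))⟩
  · by_contra! h
    exact hP (inducedP4Free_of_acceptsAt hG hid.1 h)

end PLS

theorem mainTheorem3 :
    ∃ A : PLS.Verifier, ∀ c : ℕ, 1 ≤ c →
      ∃ s : ℕ → ℕ, (fun n => (s n : ℝ)) =O[atTop] (fun n : ℕ => Real.log (n : ℝ)) ∧
        A.Certifies c s InducedP4Free.{u} :=
  ⟨PLS.cographVerifier, fun c hc =>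
    ⟨_, PLS.isBigO_size (16 * c), PLS.cographVerifier_certifies hc⟩⟩
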